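/- **Theorem (LCHS formula for unstable dynamics).** Let $N \in \mathbb{N}$, $\lambda_0 \ge 0$, $a \ge 0$, $t \ge 0$, and let $A : \mathbb{R} \to \mathbb{C}^{N\times N}$ be integrable on $[0,t]$ (for instance continuous). Write $A(s) = L(s) + iH(s)$ with the Hermitian matrices $L(s) = \frac{A(s)+A(s)^\dagger}{2}$ and $H(s) = \frac{A(s)-A(s)^\dagger}{2i}$, and suppose that $L(s) \succeq -\lambda_0 I$ for all $s \in [0,t]$. Let $F : \mathbb{R} \to \mathbb{C}$ satisfy $F(x) = e^{-x}$ for all $x \ge -a$ and $F \in C^2(\mathbb{R}) \cap W^{2,1}(\mathbb{R})$, i.e. $F$ is twice continuously differentiable and $F, F', F''$ are integrable on $\mathbb{R}$. Put $$\Phi(x) = F(x) + F'(x), \qquad f(k) = \frac{1}{2\pi}\int_{\mathbb{R}} \Phi(x)\, e^{ikx}\,\mathrm{d}x \quad (k \in \mathbb{R}).$$ If $t \le a/\lambda_0$ (that is, $\lambda_0 t \le a$; when $\lambda_0 = 0$ this allows every $t \ge 0$), then the integrand below is integrable over $k \in \mathbb{R}$ and $$\mathcal{T} e^{-\int_0^t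 A(s)\,\mathrm{d}s} = \int_{\mathbb{R}} \frac{f(k)}{1-ik}\; \mathcal{T} e^{-i\int_0^t (kL(s)+H(s))\,\mathrm{d}s}\,\mathrm{d}k .$$ Here $\mathcal{T} e^{\int_0^t B(s)\,\mathrm{d}s}$ denotes the time-ordered exponential, the sum of the Dyson series $\sum_{n \ge 0} D_n(t)$ with $D_0 = I$ and $D_{n+1}(t) = \int_0^t B(s) D_n(s)\,\mathrm{d}s$; equivalently, the value at time $t$ of the solution of $U' = BU$, $U(0) = I$. -/

import Mathlib

open scoped ComplexOrder ComplexStarModule Matrix.Norms.L2Operator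

namespace FTLCHS

/-- The `n`-th term of the Dyson series of `U' = B U`, `U 0 = 1`:
`∫_{t ≥ s₁ ≥ ⋯ ≥ sₙ ≥ 0} B(s₁) ⋯ B(sₙ)`, written as an iterated integral
(matrices at later times stand to the left). -/
noncomputable def dysonTerm {N : ℕ} (B : ℝ → Matrix (Fin N) (Fin N) ℂ) :
    ℕ → ℝ → Matrix (Fin N) (Fin N) ℂ
  | 0, _ => 1
  | n + 1, t => ∫ s in (0 : ℝ)..t, B s * dysonTerm B n s

/-- The time-ordered exponential `𝒯 exp (∫₀ᵗ B(s) ds)`, as the sum of its Dyson series. The series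
converges absolutely whenever `B` is integrable on `[0, t]`. -/
noncomputable def timeOrderedExp {N : ℕ} (B : ℝ → Matrix (Fin N) (Fin N) ℂ) (t : ℝ) :
    Matrix (Fin N) (Fin N) ℂ :=
  ∑' n : ℕ, dysonTerm B n t

/-- `F ∈ C²(ℝ) ∩ W^{2,1}(ℝ)`: twice continuously differentiable, with `F`, `F'`, `F''` integrable
(for a `C²` function the weak derivatives are the classical ones). The function `F` agrees with
`e^{-x}` on `[-a, ∞)`. -/
structure IsGenerator (a : ℝ) (F : ℝ → ℂ) : Prop where
  eq_exp : ∀ x : ℝ, -a ≤ x → F x = Complex.exp (-(x : ℂ))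
  contDiff : ContDiff ℝ 2 F
  integrable_iteratedDeriv : ∀ j : ℕ, j ≤ 2 → MeasureTheory.Integrable (iteratedDeriv j F)

/-- The generating function `Φ = F + F'`. -/
noncomputable def generatingFun (F : ℝ → ℂ) (x : ℝ) : ℂ := F x + deriv F x

/-- The kernel function `f(z) = (1 / 2π) ∫ Φ(x) e^{izx} dx`, used for `Im z ≤ 0`. -/
noncomputable def kernelFun (F : ℝ → ℂ) (z : ℂ) : ℂ :=
  1 / (2 * Real.pi) * ∫ x : ℝ, generatingFun F x * Complex.exp (Complex.I * z * x)

end FTLCHS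

/-!
Write `V(z)` for the time-ordered exponential of `-i (z L + H)` on `[0, t]`, so that `V(-i)` is the
propagator of `-A` and `V(k)`, for real `k`, is the unitary one under the integral. The LCHS formula
expresses `V(-i)` through the values of `V` on the real line, and it is an instance of the Poisson
formula `∫ W(k) / (1 + k²) dk = π W(-i)` for the lower half-plane
(`integral_inv_one_add_sq_smul_eq`), applied to `W(z) = f(z) (1 + i z) V(z)`: on the real line
`W(k) / (1 + k²) = f(k) V(k) / (1 - i k)`, and `W(-i) = 2 f(-i) V(-i) = V(-i) / π`, because
`2π f(-i) = ∫ (F + F') eˣ = ∫ (F eˣ)' = 1` (`IsGenerator.kernelFun_neg_I`).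

The formula needs `W` to be bounded and continuous on the closed lower half-plane and holomorphic
inside it.

* `V` is entire (`differentiable_timeOrderedExp_pencil`): the Dyson terms are polynomials in `z` and
  the series converges locally uniformly.
* `‖V(z)‖ ≤ exp (-λ t Im z)` for `Im z ≤ 0` (`norm_timeOrderedExp_le`, `re_inner_pencil_le`). This
  is an energy estimate; as the generator is only integrable in time, solutions are absolutely
  continuous and the estimate uses the fundamental theorem of calculus for such functions
  (`norm_le_exp_mul_of_inner_le`).
* `‖f(z) (1 + i z)‖ ≤ C exp (a Im z)` for `Im z ≤ 0` (`IsGenerator.exists_norm_kernelFun_mul_le`):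
  `F + F'` vanishes to the right of `-a`, and one integration by parts, legitimate because
  `F, F', F''` are integrable, gives the factor `1 + i z`.

The two exponentials compensate exactly when `λ t ≤ a`.
-/

namespace FTLCHS

open MeasureTheory Set Filter Topology

/-! ### Absolutely continuous functions and the energy estimate -/

theorem AbsolutelyContinuousOnInterval.of_dist_le {X Y : Type*} [PseudoMetricSpace X]
    [PseudoMetricSpace Y] {f : ℝ → X} {g : ℝ → Y} {a b C : ℝ}
    (hg : AbsolutelyContinuousOnInterval g a b)
    (h : ∀ x ∈ uIcc a b, ∀ y ∈ uIcc a b, dist (f x) (f y) ≤ C * dist (g x) (g y)) :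
    AbsolutelyContinuousOnInterval f a b := by
  unfold AbsolutelyContinuousOnInterval at hg ⊢
  refine squeeze_zero' (Eventually.of_forall fun E => Finset.sum_nonneg fun i _ => dist_nonneg) ?_
    (by simpa using hg.const_mul C)
  filter_upwards [mem_inf_of_right (mem_principal_self _)] with E hE
  rw [Finset.mul_sum]
  exact Finset.sum_le_sum fun i hi => h _ (hE.1 i hi).1 _ (hE.1 i hi).2

theorem intervalIntegrable_of_mem {E : Type*} [NormedAddCommGroup E] {g : ℝ → E} {t s r : ℝ}
    (hg : IntervalIntegrable g volume 0 t) (hs : s ∈ uIcc 0 t) (hr : r ∈ uIcc 0 t) :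
    IntervalIntegrable g volume s r :=
  hg.mono_set (uIcc_subset_uIcc hs hr)

theorem absolutelyContinuousOnInterval_integral {E : Type*} [NormedAddCommGroup E]
    [NormedSpace ℝ E] {g : ℝ → E} {t : ℝ}
    (hg : IntervalIntegrable g volume 0 t) :
    AbsolutelyContinuousOnInterval (fun s => ∫ r in (0 : ℝ)..s, g r) 0 t := by
  refine AbsolutelyContinuousOnInterval.of_dist_le (C := 1)
    (hg.norm.absolutelyContinuousOnInterval_intervalIntegral left_mem_uIcc) fun x hx y hy => ?_
  rw [one_mul, dist_eq_norm, dist_eq_norm,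
    intervalIntegral.integral_interval_sub_left (intervalIntegrable_of_mem hg left_mem_uIcc hx)
      (intervalIntegrable_of_mem hg left_mem_uIcc hy),
    intervalIntegral.integral_interval_sub_left
      (intervalIntegrable_of_mem hg.norm left_mem_uIcc hx)
      (intervalIntegrable_of_mem hg.norm left_mem_uIcc hy), Real.norm_eq_abs]
  exact intervalIntegral.norm_integral_le_abs_integral_norm

/-- `∫₀ᵗ g(s) (∫₀ˢ g)ⁿ ds = (∫₀ᵗ g)ⁿ⁺¹ / (n + 1)` for a merely integrable `g`: the chain rule holds
almost everywhere, and powers of the primitive are absolutely continuous. -/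
theorem integral_mul_primitive_pow {g : ℝ → ℝ} {t : ℝ} (hg : IntervalIntegrable g volume 0 t)
    (n : ℕ) :
    ∫ s in (0 : ℝ)..t, g s * (∫ r in (0 : ℝ)..s, g r) ^ n =
      (∫ r in (0 : ℝ)..t, g r) ^ (n + 1) / (n + 1) := by
  have hb := absolutelyContinuousOnInterval_integral hg
  have hpow : ∀ m : ℕ,
      AbsolutelyContinuousOnInterval (fun s => (∫ r in (0 : ℝ)..s, g r) ^ (m + 1)) 0 t := by
    intro m
    induction m with
    | zero => simpa using hb
    | succ k ih => simpa only [← pow_succ] using ih.fun_mul hb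
  have h1 := (hpow n).integral_deriv_eq_sub
  simp only [intervalIntegral.integral_same, zero_pow (Nat.succ_ne_zero n), sub_zero] at h1
  rw [← h1, eq_div_iff (by positivity), ← intervalIntegral.integral_mul_const]
  refine intervalIntegral.integral_congr_ae ?_
  filter_upwards [hg.ae_hasDerivAt_integral] with x hx hx'
  have := (hx (uIoc_subset_uIcc hx') 0 left_mem_uIcc).pow (n + 1)
  have h2 : deriv (fun s => (∫ r in (0 : ℝ)..s, g r) ^ (n + 1)) x = _ := this.deriv
  rw [h2, Nat.add_sub_cancel]; push_cast; ring

/-- Energy estimate: if `y' = g` almost everywhere and `⟪y, g⟫ ≤ μ ‖y‖²`, then `‖y‖` grows at most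
like `exp (μ t)`. -/
theorem norm_le_exp_mul_of_inner_le {E : Type*} [NormedAddCommGroup E] [InnerProductSpace ℝ E]
    [CompleteSpace E]
    {y g : ℝ → E} {μ t : ℝ} (ht : 0 ≤ t) (hg : IntervalIntegrable g volume 0 t)
    (hy : ∀ s ∈ Icc 0 t, y s = y 0 + ∫ r in (0 : ℝ)..s, g r)
    (hμ : ∀ s ∈ Icc 0 t, inner ℝ (y s) (g s) ≤ μ * ‖y s‖ ^ 2) :
    ‖y t‖ ≤ Real.exp (μ * t) * ‖y 0‖ := by
  have huIcc : uIcc 0 t = Icc 0 t := uIcc_of_le ht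
  have hyac : AbsolutelyContinuousOnInterval y 0 t := by
    refine AbsolutelyContinuousOnInterval.of_dist_le (C := 1)
      (absolutelyContinuousOnInterval_integral hg) fun r hr s hs => ?_
    rw [huIcc] at hr hs
    rw [hy r hr, hy s hs, dist_add_left, one_mul]
  obtain ⟨M, hM⟩ := hyac.exists_bound
  have hsq : AbsolutelyContinuousOnInterval (fun s => ‖y s‖ ^ 2) 0 t := by
    refine AbsolutelyContinuousOnInterval.of_dist_le (C := 2 * M) hyac fun r hr s hs => ?_
    have h1 : ‖y r‖ ^ 2 - ‖y s‖ ^ 2 = (‖y r‖ + ‖y s‖) * (‖y r‖ - ‖y s‖) := by ring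
    rw [Real.dist_eq, h1, abs_mul, abs_of_nonneg (by positivity : 0 ≤ ‖y r‖ + ‖y s‖),
      dist_eq_norm]
    exact mul_le_mul (by linarith [hM r hr, hM s hs]) (abs_norm_sub_norm_le _ _) (abs_nonneg _)
      (by linarith [(norm_nonneg _).trans (hM r hr)])
  have hexp : AbsolutelyContinuousOnInterval (fun s : ℝ => Real.exp (-(2 * μ * s))) 0 t :=
    ContDiffOn.absolutelyContinuousOnInterval (ContDiff.contDiffOn (by fun_prop))
  have hφ := (hexp.mul hsq).integral_deriv_eq_sub
  have hle : ∫ x in (0 : ℝ)..t, deriv ((fun s : ℝ => Real.exp (-(2 * μ * s))) *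
      fun s => ‖y s‖ ^ 2) x ≤ 0 := by
    rw [intervalIntegral.integral_of_le ht]
    refine integral_nonpos_of_ae ?_
    have hT : ∀ᵐ x : ℝ, x ≠ t := by simp [ae_iff, measure_singleton]
    rw [EventuallyLE, ae_restrict_iff' measurableSet_Ioc]
    filter_upwards [hg.ae_hasDerivAt_integral, hT] with x hx hxt hx'
    have hxI : x ∈ Ioo 0 t := ⟨hx'.1, lt_of_le_of_ne hx'.2 hxt⟩
    have hyd : HasDerivAt y (g x) x := by
      refine ((hx (huIcc ▸ Ioo_subset_Icc_self hxI) 0 left_mem_uIcc).const_add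
        (y 0)).congr_of_eventuallyEq ?_
      filter_upwards [Ioo_mem_nhds hxI.1 hxI.2] with s hs
      exact hy s (Ioo_subset_Icc_self hs)
    have he : HasDerivAt (fun s : ℝ => Real.exp (-(2 * μ * s)))
        (Real.exp (-(2 * μ * x)) * -(2 * μ)) x := by
      simpa using (((hasDerivAt_id x).const_mul (2 * μ)).neg).exp
    rw [(he.mul hyd.norm_sq).deriv]
    have := hμ x (Ioo_subset_Icc_self hxI)
    have h2 : Real.exp (-(2 * μ * x)) * -(2 * μ) * ‖y x‖ ^ 2 +
        Real.exp (-(2 * μ * x)) * (2 * inner ℝ (y x) (g x)) =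
        2 * Real.exp (-(2 * μ * x)) * (inner ℝ (y x) (g x) - μ * ‖y x‖ ^ 2) := by ring
    rw [h2]
    exact mul_nonpos_of_nonneg_of_nonpos (by positivity) (by linarith)
  rw [hφ] at hle
  simp only [Pi.mul_apply, mul_zero, neg_zero, Real.exp_zero, one_mul] at hle
  refine le_of_sq_le_sq ?_ (by positivity)
  have h3 : (Real.exp (μ * t) * ‖y 0‖) ^ 2 = Real.exp (2 * μ * t) * ‖y 0‖ ^ 2 := by
    rw [mul_pow, ← Real.exp_nat_mul]; congr 2; push_cast; ring
  rw [h3]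
  have h4 : ‖y t‖ ^ 2 = Real.exp (2 * μ * t) * (Real.exp (-(2 * μ * t)) * ‖y t‖ ^ 2) := by
    rw [← mul_assoc, ← Real.exp_add]; simp
  rw [h4]
  gcongr
  linarith

/-! ### The Dyson series -/

section Dyson

variable {N : ℕ} {B : ℝ → Matrix (Fin N) (Fin N) ℂ} {t : ℝ}

theorem continuousOn_dysonTerm (hB : IntervalIntegrable B volume 0 t) (n : ℕ) :
    ContinuousOn (dysonTerm B n) (uIcc 0 t) := by
  induction n with
  | zero => exact continuousOn_const
  | succ n ih =>
    exact intervalIntegral.continuousOn_primitive_interval' (hB.mul_continuousOn ih) left_mem_uIcc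

theorem norm_dysonTerm_le (hB : IntervalIntegrable B volume 0 t) (n : ℕ) :
    ∀ s ∈ Icc 0 t, ‖dysonTerm B n s‖ ≤ (∫ r in (0 : ℝ)..s, ‖B r‖) ^ n / n.factorial := by
  induction n with
  | zero =>
    intro s _
    have h1 : ‖(1 : Matrix (Fin N) (Fin N) ℂ)‖ ≤ 1 := by
      rw [Matrix.cstar_norm_def, map_one]
      exact ContinuousLinearMap.norm_id_le
    simpa [dysonTerm] using h1
  | succ n ih =>
    intro s hs
    have hs' : s ∈ uIcc 0 t := Icc_subset_uIcc hs
    have hBs : IntervalIntegrable B volume 0 s := intervalIntegrable_of_mem hB left_mem_uIcc hs'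
    have hint : IntervalIntegrable
        (fun r => ‖B r‖ * ((∫ r' in (0 : ℝ)..r, ‖B r'‖) ^ n / n.factorial)) volume 0 s := by
      refine hBs.norm.mul_continuousOn (ContinuousOn.div_const (ContinuousOn.pow ?_ n) _)
      exact intervalIntegral.continuousOn_primitive_interval' hBs.norm left_mem_uIcc
    calc ‖dysonTerm B (n + 1) s‖
        ≤ ∫ r in (0 : ℝ)..s, ‖B r‖ * ((∫ r' in (0 : ℝ)..r, ‖B r'‖) ^ n / n.factorial) := by
          refine intervalIntegral.norm_integral_le_of_norm_le hs.1
            (Eventually.of_forall fun r hr => ?_) hint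
          refine (norm_mul_le _ _).trans ?_
          gcongr
          exact ih r ⟨hr.1.le, hr.2.trans hs.2⟩
      _ = (∫ r in (0 : ℝ)..s, ‖B r‖) ^ (n + 1) / (n + 1).factorial := by
          simp_rw [← mul_div_assoc]
          rw [intervalIntegral.integral_div, integral_mul_primitive_pow hBs.norm, div_div,
            Nat.factorial_succ]
          push_cast; rfl

theorem norm_dysonTerm_le_of_integral_le (hB : IntervalIntegrable B volume 0 t)
    {K : ℝ} (hK : ∫ r in (0 : ℝ)..t, ‖B r‖ ≤ K) (n : ℕ) {s : ℝ} (hs : s ∈ Icc 0 t) :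
    ‖dysonTerm B n s‖ ≤ K ^ n / n.factorial := by
  refine (norm_dysonTerm_le hB n s hs).trans ?_
  have h0 : 0 ≤ ∫ r in (0 : ℝ)..s, ‖B r‖ :=
    intervalIntegral.integral_nonneg hs.1 fun _ _ => norm_nonneg _
  gcongr
  refine le_trans ?_ hK
  exact intervalIntegral.integral_mono_interval le_rfl hs.1 hs.2
    (Eventually.of_forall fun _ => norm_nonneg _) hB.norm

theorem hasSum_dysonTerm (hB : IntervalIntegrable B volume 0 t) {s : ℝ}
    (hs : s ∈ Icc 0 t) : HasSum (fun n => dysonTerm B n s) (timeOrderedExp B s) :=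
  (Summable.of_norm_bounded (Real.summable_pow_div_factorial _)
    fun n => norm_dysonTerm_le_of_integral_le hB le_rfl n hs).hasSum

theorem continuousOn_timeOrderedExp (ht : 0 ≤ t) (hB : IntervalIntegrable B volume 0 t) :
    ContinuousOn (timeOrderedExp B) (uIcc 0 t) :=
  continuousOn_tsum (continuousOn_dysonTerm hB) (Real.summable_pow_div_factorial _)
    fun n _ hs => norm_dysonTerm_le_of_integral_le hB le_rfl n (uIcc_of_le ht ▸ hs)

/-- The integral form of `U' = B U`, `U 0 = 1`. -/
theorem timeOrderedExp_eq_add_integral (hB : IntervalIntegrable B volume 0 t) {s : ℝ}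
    (hs : s ∈ Icc 0 t) :
    timeOrderedExp B s = 1 + ∫ r in (0 : ℝ)..s, B r * timeOrderedExp B r := by
  have hBs : IntervalIntegrable B volume 0 s :=
    intervalIntegrable_of_mem hB left_mem_uIcc (Icc_subset_uIcc hs)
  have h1 : HasSum (fun n => dysonTerm B (n + 1) s)
      (∫ r in (0 : ℝ)..s, B r * timeOrderedExp B r) := by
    set K := ∫ r in (0 : ℝ)..t, ‖B r‖
    refine intervalIntegral.hasSum_integral_of_dominated_convergence
      (fun n r => ‖B r‖ * (K ^ n / n.factorial)) (fun n => ?_) (fun n => ?_) ?_ ?_ ?_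
    · rw [uIoc_of_le hs.1]
      exact (hBs.mul_continuousOn (continuousOn_dysonTerm hBs n)).aestronglyMeasurable
    · refine Eventually.of_forall fun r hr => (norm_mul_le _ _).trans ?_
      rw [uIoc_of_le hs.1] at hr
      gcongr
      exact norm_dysonTerm_le_of_integral_le hB le_rfl n ⟨hr.1.le, hr.2.trans hs.2⟩
    · exact Eventually.of_forall fun r _ => (Real.summable_pow_div_factorial _).mul_left _
    · simp_rw [tsum_mul_left]
      exact hBs.norm.mul_const _
    · refine Eventually.of_forall fun r hr => ?_
      rw [uIoc_of_le hs.1] at hr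
      exact (hasSum_dysonTerm hB ⟨hr.1.le, hr.2.trans hs.2⟩).mul_left _
  have h2 := (hasSum_dysonTerm hB hs)
  rw [← hasSum_nat_add_iff' 1] at h2
  have h3 := h2.unique h1
  rw [← h3]
  simp [dysonTerm]

/-- If the numerical range of `B s` lies in `Re ≤ μ` for all `s`, the propagator of `B` grows at most
like `exp (μ t)`. -/
theorem norm_timeOrderedExp_le {μ : ℝ} (ht : 0 ≤ t) (hB : IntervalIntegrable B volume 0 t)
    (hμ : ∀ s ∈ Icc 0 t, ∀ x : EuclideanSpace ℂ (Fin N),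
      (inner ℂ x (Matrix.toEuclideanCLM (n := Fin N) (𝕜 := ℂ) (B s) x)).re ≤ μ * ‖x‖ ^ 2) :
    ‖timeOrderedExp B t‖ ≤ Real.exp (μ * t) := by
  rw [Matrix.cstar_norm_def]
  refine ContinuousLinearMap.opNorm_le_bound _ (Real.exp_nonneg _) fun x => ?_
  let T : Matrix (Fin N) (Fin N) ℂ →L[ℂ] EuclideanSpace ℂ (Fin N) := LinearMap.toContinuousLinearMap
    { toFun := fun M => Matrix.toEuclideanCLM (n := Fin N) (𝕜 := ℂ) M x
      map_add' := by simp
      map_smul' := by simp }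
  have hT : ∀ M, T M = Matrix.toEuclideanCLM (n := Fin N) (𝕜 := ℂ) M x := fun _ => rfl
  have hU0 : timeOrderedExp B 0 = 1 := by
    simpa using timeOrderedExp_eq_add_integral hB (left_mem_Icc.2 ht)
  have hint := hB.mul_continuousOn (continuousOn_timeOrderedExp ht hB)
  have key := norm_le_exp_mul_of_inner_le (y := fun s => T (timeOrderedExp B s))
    (g := fun s => T (B s * timeOrderedExp B s)) (μ := μ) ht ?_ ?_ ?_
  · simpa [hT, hU0] using key
  · exact ⟨T.integrable_comp hint.1, T.integrable_comp hint.2⟩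
  · intro s hs
    rw [timeOrderedExp_eq_add_integral hB hs, map_add, hU0]
    congr 1
    exact (T.intervalIntegral_comp_comm
      (intervalIntegrable_of_mem hint left_mem_uIcc (Icc_subset_uIcc hs))).symm
  · intro s hs
    have := hμ s hs (T (timeOrderedExp B s))
    have hre : ∀ u v : EuclideanSpace ℂ (Fin N), inner ℝ u v = (inner ℂ u v).re := fun u v => by
      simp [PiLp.inner_apply, Complex.inner]
    rw [hre]
    simpa [hT] using this

end Dyson

section Pencil

variable {N : ℕ} {B₀ B₁ : ℝ → Matrix (Fin N) (Fin N) ℂ} {t : ℝ}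

theorem intervalIntegrable_pencil (h₀ : IntervalIntegrable B₀ volume 0 t)
    (h₁ : IntervalIntegrable B₁ volume 0 t) (z : ℂ) :
    IntervalIntegrable (fun s => z • B₁ s + B₀ s) volume 0 t :=
  (h₁.smul z).add h₀

/-- The `n`-th Dyson term of the linear pencil `z B₁ + B₀` is a polynomial in `z` with coefficients
continuous in time. -/
theorem exists_dysonTerm_pencil_eq_sum (h₀ : IntervalIntegrable B₀ volume 0 t)
    (h₁ : IntervalIntegrable B₁ volume 0 t) (n : ℕ) :
    ∃ c : ℕ → ℝ → Matrix (Fin N) (Fin N) ℂ, (∀ m, ContinuousOn (c m) (uIcc 0 t)) ∧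
      ∀ z : ℂ, ∀ s ∈ uIcc 0 t,
        dysonTerm (fun s => z • B₁ s + B₀ s) n s = ∑ m ∈ Finset.range (n + 1), z ^ m • c m s := by
  induction n with
  | zero => exact ⟨fun _ _ => 1, fun _ => continuousOn_const, fun z s _ => by simp [dysonTerm]⟩
  | succ n ih =>
    obtain ⟨c, hc, hsum⟩ := ih
    have hi₁ := fun m => h₁.mul_continuousOn (hc m)
    have hi₀ := fun m => h₀.mul_continuousOn (hc m)
    -- Multiplication by `z • B₁` raises the degree, multiplication by `B₀` preserves it.
    let p : ℕ → ℝ → Matrix (Fin N) (Fin N) ℂ := fun m s =>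
      if m = 0 then 0 else ∫ r in (0 : ℝ)..s, B₁ r * c (m - 1) r
    let q : ℕ → ℝ → Matrix (Fin N) (Fin N) ℂ := fun m s =>
      if m = n + 1 then 0 else ∫ r in (0 : ℝ)..s, B₀ r * c m r
    refine ⟨fun m s => p m s + q m s, fun m => ContinuousOn.add ?_ ?_, fun z s hs => ?_⟩
    · by_cases hm : m = 0
      · simpa [p, hm] using continuousOn_const
      · simpa [p, hm] using
          intervalIntegral.continuousOn_primitive_interval' (hi₁ (m - 1)) left_mem_uIcc
    · by_cases hm : m = n + 1
      · simpa [q, hm] using continuousOn_const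
      · simpa [q, hm] using
          intervalIntegral.continuousOn_primitive_interval' (hi₀ m) left_mem_uIcc
    · have hsub : ∀ {g : ℝ → Matrix (Fin N) (Fin N) ℂ}, IntervalIntegrable g volume 0 t →
          IntervalIntegrable g volume 0 s := fun h => intervalIntegrable_of_mem h left_mem_uIcc hs
      have h1 : dysonTerm (fun s => z • B₁ s + B₀ s) (n + 1) s =
          ∫ r in (0 : ℝ)..s, ∑ m ∈ Finset.range (n + 1),
            (z ^ (m + 1) • (B₁ r * c m r) + z ^ m • (B₀ r * c m r)) := by
        refine intervalIntegral.integral_congr fun r hr => ?_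
        simp only
        rw [hsum z r (uIcc_subset_uIcc left_mem_uIcc hs hr), Finset.mul_sum]
        refine Finset.sum_congr rfl fun m _ => ?_
        rw [add_mul, mul_smul_comm, mul_smul_comm, smul_mul_assoc, smul_smul, pow_succ]
      have hint : ∀ m ∈ Finset.range (n + 1), IntervalIntegrable
          (fun r => z ^ (m + 1) • (B₁ r * c m r) + z ^ m • (B₀ r * c m r)) volume 0 s :=
        fun m _ => ((hsub (hi₁ m)).smul (z ^ (m + 1))).add ((hsub (hi₀ m)).smul (z ^ m))
      rw [h1, intervalIntegral.integral_finsetSum hint]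
      have h2 : ∀ m, ∫ r in (0 : ℝ)..s, (z ^ (m + 1) • (B₁ r * c m r) + z ^ m • (B₀ r * c m r)) =
          z ^ (m + 1) • (∫ r in (0 : ℝ)..s, B₁ r * c m r) +
            z ^ m • ∫ r in (0 : ℝ)..s, B₀ r * c m r := fun m => by
        rw [← intervalIntegral.integral_smul, ← intervalIntegral.integral_smul]
        exact intervalIntegral.integral_add ((hsub (hi₁ m)).smul (z ^ (m + 1)))
          ((hsub (hi₀ m)).smul (z ^ m))
      simp_rw [h2, smul_add, Finset.sum_add_distrib]
      congr 1
      · rw [Finset.sum_range_succ' _ (n + 1)]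
        simp [p]
      · rw [Finset.sum_range_succ _ (n + 1)]
        simp only [q, if_true, smul_zero, add_zero]
        refine Finset.sum_congr rfl fun m hm => ?_
        rw [if_neg (Finset.mem_range.1 hm).ne]

/-- The time-ordered exponential of the linear pencil `z B₁ + B₀` is an entire function of `z`. -/
theorem differentiable_timeOrderedExp_pencil (ht : 0 ≤ t) (h₀ : IntervalIntegrable B₀ volume 0 t)
    (h₁ : IntervalIntegrable B₁ volume 0 t) :
    Differentiable ℂ fun z : ℂ => timeOrderedExp (fun s => z • B₁ s + B₀ s) t := by
  intro z₀
  have hmem : Metric.ball (0 : ℂ) (‖z₀‖ + 1) ∈ 𝓝 z₀ :=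
    Metric.isOpen_ball.mem_nhds (by simp)
  refine DifferentiableOn.differentiableAt (s := Metric.ball (0 : ℂ) (‖z₀‖ + 1)) ?_ hmem
  refine Complex.differentiableOn_tsum_of_summable_norm
    (Real.summable_pow_div_factorial
      (∫ r in (0 : ℝ)..t, ((‖z₀‖ + 1) * ‖B₁ r‖ + ‖B₀ r‖)))
    (fun n => ?_) Metric.isOpen_ball (fun n z hz => ?_)
  · obtain ⟨c, -, hc⟩ := exists_dysonTerm_pencil_eq_sum h₀ h₁ n
    simp_rw [hc _ t right_mem_uIcc]
    fun_prop
  · refine norm_dysonTerm_le_of_integral_le (intervalIntegrable_pencil h₀ h₁ z) ?_ n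
      (right_mem_Icc.2 ht)
    refine intervalIntegral.integral_mono_on ht (intervalIntegrable_pencil h₀ h₁ z).norm
      ((h₁.norm.const_mul _).add h₀.norm) fun r _ => ?_
    refine (norm_add_le _ _).trans ?_
    rw [norm_smul]
    gcongr
    simpa using (mem_ball_zero_iff.1 hz).le

end Pencil

/-! ### The kernel function in the lower half-plane -/

section FourierLaplace

variable {G : ℝ → ℂ} {a : ℝ}

theorem norm_cexp_I_mul (z : ℂ) (x : ℝ) :
    ‖Complex.exp (Complex.I * z * x)‖ = Real.exp (-z.im * x) := by
  rw [Complex.norm_exp]; congr 1; simp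

/-- For `G` supported in `(-∞, -a]`, the exponential `exp (i z x)` contributes the decay
`exp (a Im z)` on the lower half-plane. -/
theorem norm_mul_cexp_le (hG : ∀ x, -a < x → G x = 0) {z : ℂ} (hz : z.im ≤ 0) (x : ℝ) :
    ‖G x * Complex.exp (Complex.I * z * x)‖ ≤ ‖G x‖ * Real.exp (a * z.im) := by
  rcases lt_or_ge (-a) x with hx | hx
  · simp [hG x hx]
  · rw [norm_mul, norm_cexp_I_mul]
    refine mul_le_mul_of_nonneg_left (Real.exp_le_exp.2 ?_) (norm_nonneg _)
    nlinarith [mul_nonneg (neg_nonneg.2 hz) (sub_nonneg.2 hx)]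

theorem continuous_cexp_I_mul (z : ℂ) :
    Continuous fun x : ℝ => Complex.exp (Complex.I * z * x) := by fun_prop

theorem integrable_mul_cexp (hGi : Integrable G) (hG : ∀ x, -a < x → G x = 0) {z : ℂ}
    (hz : z.im ≤ 0) : Integrable fun x : ℝ => G x * Complex.exp (Complex.I * z * x) :=
  (hGi.norm.mul_const (Real.exp (a * z.im))).mono'
    (hGi.aestronglyMeasurable.mul (continuous_cexp_I_mul z).aestronglyMeasurable)
    (Eventually.of_forall (norm_mul_cexp_le hG hz))

theorem norm_integral_mul_cexp_le (hGi : Integrable G) (hG : ∀ x, -a < x → G x = 0) {z : ℂ}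
    (hz : z.im ≤ 0) :
    ‖∫ x : ℝ, G x * Complex.exp (Complex.I * z * x)‖ ≤ (∫ x, ‖G x‖) * Real.exp (a * z.im) := by
  rw [← integral_mul_const]
  exact norm_integral_le_of_norm_le (hGi.norm.mul_const _)
    (Eventually.of_forall (norm_mul_cexp_le hG hz))

theorem continuousOn_integral_mul_cexp (ha : 0 ≤ a) (hGi : Integrable G)
    (hG : ∀ x, -a < x → G x = 0) :
    ContinuousOn (fun z : ℂ => ∫ x : ℝ, G x * Complex.exp (Complex.I * z * x))
      {z | z.im ≤ 0} := by
  refine continuousOn_of_dominated (bound := fun x => ‖G x‖)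
    (fun z hz => (integrable_mul_cexp hGi hG hz).aestronglyMeasurable) (fun z hz => ?_) hGi.norm ?_
  · refine Eventually.of_forall fun x => (norm_mul_cexp_le hG hz x).trans ?_
    refine mul_le_of_le_one_right (norm_nonneg _) (Real.exp_le_one_iff.2 ?_)
    exact mul_nonpos_of_nonneg_of_nonpos ha hz
  · exact Eventually.of_forall fun x => by fun_prop

theorem differentiableAt_integral_mul_cexp (ha : 0 ≤ a) (hGi : Integrable G)
    (hG : ∀ x, -a < x → G x = 0) {z₀ : ℂ} (hz₀ : z₀.im < 0) :
    DifferentiableAt ℂ (fun z : ℂ => ∫ x : ℝ, G x * Complex.exp (Complex.I * z * x)) z₀ := by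
  set δ := -z₀.im / 2 with hδ
  have hδ0 : 0 < δ := by linarith
  have him : ∀ z ∈ Metric.ball z₀ δ, z.im < -δ := fun z hz => by
    have h1 : |(z - z₀).im| < δ :=
      (Complex.abs_im_le_norm _).trans_lt (by rwa [← dist_eq_norm, ← Metric.mem_ball])
    have h2 := (abs_lt.1 h1).2
    rw [Complex.sub_im] at h2
    linarith
  have hmeas : ∀ z : ℂ, AEStronglyMeasurable
      (fun x : ℝ => G x * Complex.exp (Complex.I * z * x)) volume := fun z =>
    hGi.aestronglyMeasurable.mul (continuous_cexp_I_mul z).aestronglyMeasurable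
  refine (hasDerivAt_integral_of_dominated_loc_of_deriv_le
    (F' := fun z x => G x * (Complex.exp (Complex.I * z * x) * (Complex.I * x)))
    (bound := fun x => ‖G x‖ * δ⁻¹) (Metric.ball_mem_nhds z₀ hδ0)
    (Eventually.of_forall hmeas) (integrable_mul_cexp hGi hG hz₀.le) ?_ ?_
    (hGi.norm.mul_const _) ?_).2.differentiableAt
  · exact hGi.aestronglyMeasurable.mul (Continuous.aestronglyMeasurable (by fun_prop))
  · refine Eventually.of_forall fun x z hz => ?_
    rcases lt_or_ge (-a) x with hx | hx
    · simp [hG x hx]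
    -- `|x| exp (δ x) ≤ 1 / δ` for `x ≤ 0`
    · have hx0 : x ≤ 0 := by linarith
      rw [norm_mul, norm_mul, norm_cexp_I_mul]
      gcongr
      have h1 : Real.exp (-z.im * x) ≤ Real.exp (δ * x) := by
        apply Real.exp_le_exp.2
        nlinarith [him z hz]
      have h2 : ‖Complex.I * (x : ℂ)‖ = -x := by simp [abs_of_nonpos hx0]
      rw [h2, ← one_div, le_div_iff₀ hδ0]
      have h3 : -(δ * x) ≤ Real.exp (-(δ * x)) := by
        linarith [Real.add_one_le_exp (-(δ * x))]
      calc Real.exp (-z.im * x) * -x * δ = Real.exp (-z.im * x) * (-(δ * x)) := by ring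
        _ ≤ Real.exp (δ * x) * Real.exp (-(δ * x)) := by
          refine mul_le_mul h1 h3 ?_ (Real.exp_nonneg _)
          nlinarith
        _ = 1 := by rw [← Real.exp_add]; simp
  · refine Eventually.of_forall fun x z _ => ?_
    have h1 : HasDerivAt (fun z : ℂ => Complex.I * z * x) (Complex.I * x) z := by
      simpa using ((hasDerivAt_id z).const_mul Complex.I).mul_const (x : ℂ)
    exact h1.cexp.const_mul _

end FourierLaplace

section Kernel

variable {a : ℝ} {F : ℝ → ℂ}

namespace IsGenerator

theorem hasDerivAt (hF : IsGenerator a F) (x : ℝ) : HasDerivAt F (deriv F x) x :=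
  (hF.contDiff.differentiable (by norm_num) x).hasDerivAt

theorem hasDerivAt_deriv (hF : IsGenerator a F) (x : ℝ) :
    HasDerivAt (deriv F) (iteratedDeriv 2 F x) x := by
  have h : ContDiff ℝ 1 (deriv F) := by
    have := hF.contDiff
    rw [show (2 : WithTop ℕ∞) = 1 + 1 by norm_num, contDiff_succ_iff_deriv] at this
    exact this.2.2
  rw [iteratedDeriv_succ, iteratedDeriv_one]
  exact (h.differentiable (by norm_num) x).hasDerivAt

theorem integrable (hF : IsGenerator a F) : Integrable F := by
  simpa using hF.integrable_iteratedDeriv 0 (by norm_num)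

theorem integrable_deriv (hF : IsGenerator a F) : Integrable (deriv F) := by
  simpa using hF.integrable_iteratedDeriv 1 (by norm_num)

theorem integrable_generatingFun (hF : IsGenerator a F) : Integrable (generatingFun F) :=
  hF.integrable.add hF.integrable_deriv

theorem hasDerivAt_generatingFun (hF : IsGenerator a F) (x : ℝ) :
    HasDerivAt (generatingFun F) (deriv F x + iteratedDeriv 2 F x) x :=
  (hF.hasDerivAt x).add (hF.hasDerivAt_deriv x)

theorem integrable_deriv_generatingFun (hF : IsGenerator a F) :
    Integrable (deriv (generatingFun F)) := by
  rw [show deriv (generatingFun F) = fun x => deriv F x + iteratedDeriv 2 F x from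
    funext fun x => (hF.hasDerivAt_generatingFun x).deriv]
  exact hF.integrable_deriv.add (hF.integrable_iteratedDeriv 2 le_rfl)

theorem generatingFun_eq_zero (hF : IsGenerator a F) (x : ℝ) (hx : -a < x) :
    generatingFun F x = 0 := by
  have h1 : F =ᶠ[𝓝 x] fun x : ℝ => Complex.exp (-(x : ℂ)) := by
    filter_upwards [Ioi_mem_nhds hx] with y hy using hF.eq_exp y (le_of_lt hy)
  have h2 : HasDerivAt (fun x : ℝ => Complex.exp (-(x : ℂ))) (Complex.exp (-(x : ℂ)) * -1) x :=
    (Complex.ofRealCLM.hasDerivAt (x := x)).neg.cexp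
  rw [generatingFun, h1.eq_of_nhds, h1.deriv_eq, h2.deriv]
  ring

theorem deriv_generatingFun_eq_zero (hF : IsGenerator a F) (x : ℝ) (hx : -a < x) :
    deriv (generatingFun F) x = 0 := by
  have h1 : generatingFun F =ᶠ[𝓝 x] fun _ => 0 := by
    filter_upwards [Ioi_mem_nhds hx] with y hy using hF.generatingFun_eq_zero y hy
  rw [h1.deriv_eq, deriv_const]

/-- Integration by parts, which trades a factor `z` for a derivative of `Φ = F + F'`. -/
theorem I_mul_integral_generatingFun (hF : IsGenerator a F) {z : ℂ} (hz : z.im ≤ 0) :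
    Complex.I * z * ∫ x : ℝ, generatingFun F x * Complex.exp (Complex.I * z * x) =
      -∫ x : ℝ, deriv (generatingFun F) x * Complex.exp (Complex.I * z * x) := by
  have hint := integrable_mul_cexp hF.integrable_generatingFun hF.generatingFun_eq_zero hz
  have hint' := integrable_mul_cexp hF.integrable_deriv_generatingFun
    hF.deriv_generatingFun_eq_zero hz
  have hv : ∀ x : ℝ, HasDerivAt (fun x : ℝ => Complex.exp (Complex.I * z * x))
      (Complex.exp (Complex.I * z * x) * (Complex.I * z)) x := fun x => by
    simpa using ((Complex.ofRealCLM.hasDerivAt (x := x)).const_mul (Complex.I * z)).cexp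
  rw [← integral_mul_deriv_eq_deriv_mul_of_integrable (u := generatingFun F)
    (fun x _ => (hF.hasDerivAt_generatingFun x).differentiableAt.hasDerivAt) (fun x _ => hv x)
    ?_ hint' hint, ← integral_const_mul]
  · refine integral_congr_ae (Eventually.of_forall fun x => ?_)
    simp only
    ring
  · refine (hint.mul_const (Complex.I * z)).congr (Eventually.of_forall fun x => ?_)
    simp only [Pi.mul_apply]
    ring

/-- Besides the decay `exp (a Im z)` from the support of `Φ`, the kernel has one order of decay
`1 / |z|` from its regularity. -/
theorem exists_norm_kernelFun_mul_le (hF : IsGenerator a F) :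
    ∃ C : ℝ, 0 ≤ C ∧ ∀ z : ℂ, z.im ≤ 0 →
      ‖kernelFun F z * (1 + Complex.I * z)‖ ≤ C * Real.exp (a * z.im) := by
  refine ⟨‖(1 / (2 * Real.pi) : ℂ)‖ *
    ((∫ x, ‖generatingFun F x‖) + ∫ x, ‖deriv (generatingFun F) x‖),
    mul_nonneg (norm_nonneg _) (add_nonneg (integral_nonneg fun _ => norm_nonneg _)
      (integral_nonneg fun _ => norm_nonneg _)), fun z hz => ?_⟩
  have h1 : kernelFun F z * (1 + Complex.I * z) = 1 / (2 * Real.pi) *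
      ((∫ x : ℝ, generatingFun F x * Complex.exp (Complex.I * z * x)) -
        ∫ x : ℝ, deriv (generatingFun F) x * Complex.exp (Complex.I * z * x)) := by
    rw [sub_eq_add_neg, ← hF.I_mul_integral_generatingFun hz, kernelFun]
    ring
  rw [h1, norm_mul, mul_assoc, add_mul]
  gcongr
  refine (norm_sub_le _ _).trans (add_le_add ?_ ?_)
  · exact norm_integral_mul_cexp_le hF.integrable_generatingFun hF.generatingFun_eq_zero hz
  · exact norm_integral_mul_cexp_le hF.integrable_deriv_generatingFun
      hF.deriv_generatingFun_eq_zero hz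

theorem continuousOn_kernelFun (ha : 0 ≤ a) (hF : IsGenerator a F) :
    ContinuousOn (kernelFun F) {z | z.im ≤ 0} :=
  continuousOn_const.mul
    (continuousOn_integral_mul_cexp ha hF.integrable_generatingFun hF.generatingFun_eq_zero)

theorem differentiableAt_kernelFun (ha : 0 ≤ a) (hF : IsGenerator a F) {z : ℂ} (hz : z.im < 0) :
    DifferentiableAt ℂ (kernelFun F) z :=
  (differentiableAt_integral_mul_cexp ha hF.integrable_generatingFun hF.generatingFun_eq_zero
    hz).const_mul _

/-- At `z = -i` the integrand `(F + F') eˣ` is the derivative of `F eˣ`, which is `1` near `+∞` and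
vanishes at `-∞`. -/
theorem kernelFun_neg_I (hF : IsGenerator a F) :
    kernelFun F (-Complex.I) = 1 / (2 * Real.pi) := by
  have hexp : ∀ x : ℝ, Complex.exp (Complex.I * (-Complex.I) * x) = Complex.exp x := fun x => by
    rw [mul_neg, Complex.I_mul_I]; simp
  have hint := integrable_mul_cexp hF.integrable_generatingFun hF.generatingFun_eq_zero
    (z := -Complex.I) (by simp)
  simp_rw [hexp] at hint
  have hd : ∀ x : ℝ, HasDerivAt (fun x : ℝ => F x * Complex.exp x)
      (generatingFun F x * Complex.exp x) x := fun x => by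
    convert! (hF.hasDerivAt x).mul (Complex.ofRealCLM.hasDerivAt (x := x)).cexp using 1
    simp [generatingFun]; ring
  have hbot : Tendsto (fun x : ℝ => F x * Complex.exp x) atBot (𝓝 0) := by
    have h1 : Tendsto F atBot (𝓝 0) :=
      tendsto_zero_of_hasDerivAt_of_integrableOn_Iic (a := 0) (fun x _ => hF.hasDerivAt x)
        hF.integrable_deriv.integrableOn hF.integrable.integrableOn
    have h2 : Tendsto (fun x : ℝ => Complex.exp x) atBot (𝓝 0) := by
      rw [tendsto_zero_iff_norm_tendsto_zero]
      simpa [Complex.norm_exp] using Real.tendsto_exp_atBot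
    simpa using h1.mul h2
  have htop : Tendsto (fun x : ℝ => F x * Complex.exp x) atTop (𝓝 1) := by
    refine tendsto_const_nhds.congr' ?_
    filter_upwards [eventually_ge_atTop (-a)] with x hx
    rw [hF.eq_exp x hx, ← Complex.exp_add]
    simp
  rw [kernelFun]
  simp_rw [hexp]
  rw [integral_of_hasDerivAt_of_tendsto hd hint hbot htop]
  simp

end IsGenerator

end Kernel

/-! ### The Poisson formula for the lower half-plane -/

section Poisson

/-- The Cayley map from the unit disc onto the lower half-plane, sending `0` to `-i` and the unit
circle minus `1` onto the real line. -/
noncomputable def cayley (w : ℂ) : ℂ := -Complex.I * ((1 + w) / (1 - w))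

theorem cayley_zero : cayley 0 = -Complex.I := by simp [cayley]

theorem cayley_im (w : ℂ) : (cayley w).im = (‖w‖ ^ 2 - 1) / ‖1 - w‖ ^ 2 := by
  rw [← Complex.normSq_eq_norm_sq, ← Complex.normSq_eq_norm_sq]
  simp only [cayley, Complex.mul_im, Complex.neg_re, Complex.I_re, Complex.neg_im, Complex.I_im,
    Complex.div_re, Complex.div_im, Complex.add_re, Complex.sub_re, Complex.one_re, Complex.add_im,
    Complex.sub_im, Complex.one_im]
  rw [← add_div, ← sub_div]
  simp [Complex.normSq_apply]
  ring

theorem cayley_im_neg {w : ℂ} (hw : ‖w‖ < 1) : (cayley w).im < 0 := by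
  have h1 : (1 : ℂ) - w ≠ 0 := fun h => by
    rw [← sub_eq_zero.1 h] at hw; simp at hw
  rw [cayley_im]
  exact div_neg_of_neg_of_pos (by nlinarith [norm_nonneg w]) (by positivity)

theorem differentiableAt_cayley {w : ℂ} (hw : w ≠ 1) : DifferentiableAt ℂ cayley w := by
  unfold cayley
  have : 1 - w ≠ 0 := sub_ne_zero.2 hw.symm
  fun_prop (disch := assumption)

theorem circleMap_pi_sub_two_arctan (x : ℝ) :
    circleMap 0 1 (Real.pi - 2 * Real.arctan x) = (x + Complex.I) / (x - Complex.I) := by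
  have hx : (x : ℂ) - Complex.I ≠ 0 := fun h => by simpa using congrArg Complex.im h
  have hsx : Real.sin (Real.arctan x) = x * Real.cos (Real.arctan x) := by
    rw [← Real.tan_mul_cos (Real.cos_arctan_pos x).ne', Real.tan_arctan]
  have hsc := Real.sin_sq_add_cos_sq (Real.arctan x)
  have h1 : circleMap 0 1 (Real.pi - 2 * Real.arctan x) =
      (Real.cos (Real.pi - 2 * Real.arctan x) : ℂ) +
        (Real.sin (Real.pi - 2 * Real.arctan x) : ℂ) * Complex.I := by
    rw [circleMap, Complex.ofReal_cos, Complex.ofReal_sin, Complex.exp_mul_I]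
    simp
  rw [h1, eq_div_iff hx, Real.cos_pi_sub, Real.sin_pi_sub, Real.cos_two_mul, Real.sin_two_mul, hsx]
  rw [hsx] at hsc
  generalize Real.cos (Real.arctan x) = c at hsc
  have hsc' : ((x : ℂ) * c) ^ 2 + (c : ℂ) ^ 2 = 1 := by exact_mod_cast hsc
  push_cast
  linear_combination 2 * Complex.I * hsc' - 2 * x * (c : ℂ) ^ 2 * Complex.I_sq

theorem cayley_circleMap (x : ℝ) : cayley (circleMap 0 1 (Real.pi - 2 * Real.arctan x)) = x := by
  have hx : (x : ℂ) - Complex.I ≠ 0 := fun h => by simpa using congrArg Complex.im h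
  rw [circleMap_pi_sub_two_arctan, cayley]
  have h1 : 1 + ((x : ℂ) + Complex.I) / (x - Complex.I) = 2 * x / (x - Complex.I) := by
    field_simp; ring
  have h2 : 1 - ((x : ℂ) + Complex.I) / (x - Complex.I) = -(2 * Complex.I) / (x - Complex.I) := by
    field_simp; ring
  rw [h1, h2, div_div_div_cancel_right₀ hx]
  field_simp

theorem circleMap_ne_one {θ : ℝ} (hθ : θ ∈ Ioo 0 (2 * Real.pi)) : circleMap 0 1 θ ≠ 1 := by
  intro h
  have : Complex.exp (θ * Complex.I) = 1 := by simpa [circleMap] using h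
  obtain ⟨n, hn⟩ := Complex.exp_eq_one_iff.1 this
  have h2 : θ = n * (2 * Real.pi) := by
    have := congrArg Complex.im hn
    simpa using this
  have hpi := Real.two_pi_pos
  rw [h2] at hθ
  have h3 : (0 : ℝ) < n := by by_contra hc; nlinarith [hθ.1]
  have h4 : (n : ℝ) < 1 := by by_contra hc; nlinarith [hθ.2]
  have h5 : 0 < n := by exact_mod_cast h3
  have h6 : n < 1 := by exact_mod_cast h4
  omega

theorem image_pi_sub_two_arctan :
    (fun x : ℝ => Real.pi - 2 * Real.arctan x) '' univ = Ioo 0 (2 * Real.pi) := by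
  ext θ
  simp only [image_univ, mem_range, mem_Ioo]
  constructor
  · rintro ⟨x, rfl⟩
    constructor <;> linarith [Real.neg_pi_div_two_lt_arctan x, Real.arctan_lt_pi_div_two x]
  · rintro ⟨h1, h2⟩
    refine ⟨Real.tan ((Real.pi - θ) / 2), ?_⟩
    rw [Real.arctan_tan (by linarith) (by linarith)]
    ring

variable {E : Type*} [NormedAddCommGroup E] [NormedSpace ℂ E]

/-- The Poisson formula at `-i` for a bounded holomorphic function on the lower half-plane with
continuous boundary values: the mean value property on the unit disc, transported by the Cayley
map. The radii increase to `1` because nothing is assumed at infinity beyond boundedness. -/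
theorem integral_inv_one_add_sq_smul_eq [CompleteSpace E] {W : ℂ → E} {C : ℝ}
    (hd : ∀ z : ℂ, z.im < 0 → DifferentiableAt ℂ W z)
    (hc : ContinuousOn W {z | z.im ≤ 0}) (hb : ∀ z : ℂ, z.im ≤ 0 → ‖W z‖ ≤ C) :
    ∫ x : ℝ, (1 + x ^ 2)⁻¹ • W x = Real.pi • W (-Complex.I) := by
  have hnorm : ∀ (r θ : ℝ), 0 ≤ r → ‖circleMap 0 r θ‖ = r := fun r θ hr => by simp [abs_of_nonneg hr]
  have hne : ∀ {w : ℂ}, ‖w‖ < 1 → w ≠ 1 := fun h h' => by rw [h'] at h; simp at h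
  -- Mean value property on circles inside the disc
  have hmean : ∀ r : ℝ, 0 ≤ r → r < 1 →
      ∫ θ in (0 : ℝ)..2 * Real.pi, W (cayley (circleMap 0 r θ)) =
        (2 * Real.pi) • W (-Complex.I) := by
    intro r hr0 hr1
    have hdiff : DifferentiableOn ℂ (fun w => W (cayley w)) (Metric.ball 0 1) := by
      intro w hw
      have hw' : ‖w‖ < 1 := by simpa using hw
      exact ((hd _ (cayley_im_neg hw')).comp w
        (differentiableAt_cayley (hne hw'))).differentiableWithinAt
    have h1 : DiffContOnCl ℂ (fun w => W (cayley w)) (Metric.ball 0 |r|) := by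
      refine DifferentiableOn.diffContOnCl (hdiff.mono ?_)
      refine Metric.closure_ball_subset_closedBall.trans (Metric.closedBall_subset_ball ?_)
      rwa [abs_of_nonneg hr0]
    have h2 := h1.circleAverage
    rw [Real.circleAverage_def, cayley_zero, inv_smul_eq_iff₀ Real.two_pi_pos.ne'] at h2
    exact h2
  -- Let the radius tend to `1`
  have hlim : Tendsto (fun r : ℝ => ∫ θ in (0 : ℝ)..2 * Real.pi, W (cayley (circleMap 0 r θ)))
      (𝓝[<] 1) (𝓝 (∫ θ in (0 : ℝ)..2 * Real.pi, W (cayley (circleMap 0 1 θ)))) := by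
    have hev : ∀ᶠ r : ℝ in 𝓝[<] 1, 0 ≤ r ∧ r < 1 := by
      filter_upwards [Ioo_mem_nhdsLT (zero_lt_one' ℝ)] with r hr using ⟨hr.1.le, hr.2⟩
    refine intervalIntegral.tendsto_integral_filter_of_dominated_convergence (fun _ => C) ?_ ?_
      intervalIntegrable_const ?_
    · filter_upwards [hev] with r hr
      refine Continuous.aestronglyMeasurable (continuous_iff_continuousAt.2 fun θ => ?_)
      have hw : ‖circleMap 0 r θ‖ < 1 := by rw [hnorm r θ hr.1]; exact hr.2
      exact ContinuousAt.comp (f := fun θ => cayley (circleMap 0 r θ))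
        (hd _ (cayley_im_neg hw)).continuousAt
        (ContinuousAt.comp (f := circleMap 0 r) (differentiableAt_cayley (hne hw)).continuousAt
          (continuous_circleMap 0 r).continuousAt)
    · filter_upwards [hev] with r hr
      refine Eventually.of_forall fun θ _ => hb _ (cayley_im_neg ?_).le
      rw [hnorm r θ hr.1]; exact hr.2
    · have hT : ∀ᵐ θ : ℝ, θ ≠ 2 * Real.pi := by simp [ae_iff, measure_singleton]
      filter_upwards [hT] with θ hθ hθ'
      rw [uIoc_of_le Real.two_pi_pos.le] at hθ'
      have h1 := circleMap_ne_one ⟨hθ'.1, lt_of_le_of_ne hθ'.2 hθ⟩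
      have him : (cayley (circleMap 0 1 θ)).im ≤ 0 := by
        rw [cayley_im, hnorm 1 θ zero_le_one]; simp
      refine (hc _ him).tendsto.comp (tendsto_nhdsWithin_iff.2 ⟨?_, ?_⟩)
      · have h2 : Tendsto (fun r : ℝ => circleMap 0 r θ) (𝓝[<] 1) (𝓝 (circleMap 0 1 θ)) := by
          refine Tendsto.mono_left ?_ nhdsWithin_le_nhds
          refine Continuous.tendsto (f := fun r : ℝ => circleMap 0 r θ) ?_ 1
          unfold circleMap
          fun_prop
        exact (differentiableAt_cayley h1).continuousAt.tendsto.comp h2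
      · filter_upwards [hev] with r hr
        refine (cayley_im_neg ?_).le
        rw [hnorm r θ hr.1]; exact hr.2
  have hcircle : ∫ θ in (0 : ℝ)..2 * Real.pi, W (cayley (circleMap 0 1 θ)) =
      (2 * Real.pi) • W (-Complex.I) := by
    refine tendsto_nhds_unique hlim (tendsto_const_nhds.congr' ?_)
    filter_upwards [Ioo_mem_nhdsLT (zero_lt_one' ℝ)] with r hr using (hmean r hr.1.le hr.2).symm
  -- Substitute `θ = π - 2 arctan x`
  have hsubst := integral_image_eq_integral_abs_deriv_smul (s := univ)
    (f := fun x : ℝ => Real.pi - 2 * Real.arctan x) (f' := fun x => -(2 * (1 / (1 + x ^ 2))))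
    MeasurableSet.univ
    (fun x _ => (((Real.hasDerivAt_arctan x).const_mul 2).const_sub _).hasDerivWithinAt)
    (fun x _ y _ hxy => Real.arctan_injective (by simpa using hxy))
    (fun θ => W (cayley (circleMap 0 1 θ)))
  rw [image_pi_sub_two_arctan, ← integral_Ioc_eq_integral_Ioo,
    ← intervalIntegral.integral_of_le Real.two_pi_pos.le, hcircle, setIntegral_univ] at hsubst
  have habs : ∀ x : ℝ, |-(2 * (1 / (1 + x ^ 2)))| = 2 * (1 + x ^ 2)⁻¹ := fun x => by
    rw [abs_neg, abs_of_nonneg (by positivity), one_div]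
  simp_rw [cayley_circleMap, habs, mul_smul] at hsubst
  rw [integral_smul] at hsubst
  exact (smul_right_injective E (two_ne_zero (α := ℝ)) hsubst).symm

end Poisson

/-! ### Numerical range of the generator -/

section Matrix

variable {N : ℕ}

theorem intervalIntegrable_realPart {A : ℝ → Matrix (Fin N) (Fin N) ℂ} {t : ℝ}
    (hA : IntervalIntegrable A volume 0 t) :
    IntervalIntegrable (fun s => (ℜ (A s) : Matrix (Fin N) (Fin N) ℂ)) volume 0 t := by
  let R : Matrix (Fin N) (Fin N) ℂ →L[ℝ] Matrix (Fin N) (Fin N) ℂ := LinearMap.toContinuousLinearMap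
    { toFun := fun M => (ℜ M : Matrix (Fin N) (Fin N) ℂ)
      map_add' := by simp
      map_smul' := by simp }
  exact ⟨R.integrable_comp hA.1, R.integrable_comp hA.2⟩

theorem intervalIntegrable_imaginaryPart {A : ℝ → Matrix (Fin N) (Fin N) ℂ} {t : ℝ}
    (hA : IntervalIntegrable A volume 0 t) :
    IntervalIntegrable (fun s => (ℑ (A s) : Matrix (Fin N) (Fin N) ℂ)) volume 0 t := by
  let R : Matrix (Fin N) (Fin N) ℂ →L[ℝ] Matrix (Fin N) (Fin N) ℂ := LinearMap.toContinuousLinearMap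
    { toFun := fun M => (ℑ M : Matrix (Fin N) (Fin N) ℂ)
      map_add' := by simp
      map_smul' := by simp }
  exact ⟨R.integrable_comp hA.1, R.integrable_comp hA.2⟩

theorem im_inner_toEuclideanCLM_self {M : Matrix (Fin N) (Fin N) ℂ} (hM : IsSelfAdjoint M)
    (x : EuclideanSpace ℂ (Fin N)) :
    (inner ℂ x (Matrix.toEuclideanCLM (n := Fin N) (𝕜 := ℂ) M x)).im = 0 :=
  (ContinuousLinearMap.isSelfAdjoint_iff_isSymmetric.1
    (hM.map (Matrix.toEuclideanCLM (n := Fin N) (𝕜 := ℂ)))).im_inner_self_apply x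

theorem neg_mul_norm_sq_le_re_inner {M : Matrix (Fin N) (Fin N) ℂ} {lam : ℝ}
    (hM : (M + (lam : ℂ) • (1 : Matrix (Fin N) (Fin N) ℂ)).PosSemidef)
    (x : EuclideanSpace ℂ (Fin N)) :
    -lam * ‖x‖ ^ 2 ≤ (inner ℂ x (Matrix.toEuclideanCLM (n := Fin N) (𝕜 := ℂ) M x)).re := by
  have h1 := (Matrix.isPositive_toEuclideanLin_iff.2 hM).re_inner_nonneg_right x
  have h2 : (M + (lam : ℂ) • (1 : Matrix (Fin N) (Fin N) ℂ)).toEuclideanLin x =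
      Matrix.toEuclideanCLM (n := Fin N) (𝕜 := ℂ) M x + (lam : ℂ) • x := by
    change Matrix.toEuclideanCLM (n := Fin N) (𝕜 := ℂ) _ x = _
    rw [map_add, map_smul, map_one]
    rfl
  rw [h2, inner_add_right, inner_smul_right, inner_self_eq_norm_sq_to_K] at h1
  have h3 : ((lam : ℂ) * ((‖x‖ : ℝ) : ℂ) ^ 2).re = lam * ‖x‖ ^ 2 := by norm_cast
  have h4 : (0 : ℝ) ≤ (inner ℂ x (Matrix.toEuclideanCLM (n := Fin N) (𝕜 := ℂ) M x) +
      (lam : ℂ) * ((‖x‖ : ℝ) : ℂ) ^ 2).re := h1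
  rw [Complex.add_re, h3] at h4
  linarith

/-- For Hermitian `L ⪰ -λ` and Hermitian `H`, the generator `-i (z L + H)` with `Im z ≤ 0` has
numerical range in the half-plane `Re ≤ -λ Im z`. -/
theorem re_inner_pencil_le {L H : Matrix (Fin N) (Fin N) ℂ} {lam : ℝ} (hLsa : IsSelfAdjoint L)
    (hH : IsSelfAdjoint H) (hL : (L + (lam : ℂ) • (1 : Matrix (Fin N) (Fin N) ℂ)).PosSemidef)
    {z : ℂ} (hz : z.im ≤ 0) (x : EuclideanSpace ℂ (Fin N)) :
    (inner ℂ x (Matrix.toEuclideanCLM (n := Fin N) (𝕜 := ℂ)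
      (z • (-Complex.I • L) + -Complex.I • H) x)).re ≤ -z.im * lam * ‖x‖ ^ 2 := by
  have h1 := im_inner_toEuclideanCLM_self hLsa x
  have h2 := im_inner_toEuclideanCLM_self hH x
  have h3 := neg_mul_norm_sq_le_re_inner hL x
  simp only [map_add, map_smul, add_apply, smul_apply, inner_add_right,
    inner_smul_right]
  simp [h1, h2]
  nlinarith

end Matrix

end FTLCHS

theorem mainTheorem2 (N : ℕ) (A : ℝ → Matrix (Fin N) (Fin N) ℂ) (lam a t : ℝ) (F : ℝ → ℂ)
    (hlam : 0 ≤ lam) (ha : 0 ≤ a) (hF : FTLCHS.IsGenerator a F)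
    (ht : 0 ≤ t) (hta : lam * t ≤ a)
    (hA : IntervalIntegrable A MeasureTheory.volume 0 t)
    (hL : ∀ s ∈ Set.Icc (0 : ℝ) t,
      ((ℜ (A s) : Matrix (Fin N) (Fin N) ℂ) + (lam : ℂ) • (1 : Matrix (Fin N) (Fin N) ℂ)).PosSemidef) :
    MeasureTheory.Integrable (fun k : ℝ =>
      (FTLCHS.kernelFun F k / (1 - Complex.I * k)) •
        FTLCHS.timeOrderedExp (fun s : ℝ => -Complex.I •
          ((k : ℂ) • (ℜ (A s) : Matrix (Fin N) (Fin N) ℂ) + (ℑ (A s) : Matrix (Fin N) (Fin N) ℂ))) t) ∧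
    FTLCHS.timeOrderedExp (fun s : ℝ => -A s) t =
      ∫ k : ℝ, (FTLCHS.kernelFun F k / (1 - Complex.I * k)) •
        FTLCHS.timeOrderedExp (fun s : ℝ => -Complex.I •
          ((k : ℂ) • (ℜ (A s) : Matrix (Fin N) (Fin N) ℂ) + (ℑ (A s) : Matrix (Fin N) (Fin N) ℂ))) t := by
  have h₁ := (FTLCHS.intervalIntegrable_realPart hA).smul (-Complex.I)
  have h₀ := (FTLCHS.intervalIntegrable_imaginaryPart hA).smul (-Complex.I)
  -- the propagator at complex frequency `z`
  let V : ℂ → Matrix (Fin N) (Fin N) ℂ := fun z => FTLCHS.timeOrderedExp (fun s : ℝ =>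
    z • (-Complex.I • (ℜ (A s) : Matrix (Fin N) (Fin N) ℂ)) +
      -Complex.I • (ℑ (A s) : Matrix (Fin N) (Fin N) ℂ)) t
  have hVd : Differentiable ℂ V := FTLCHS.differentiable_timeOrderedExp_pencil ht h₀ h₁
  have hVb : ∀ z : ℂ, z.im ≤ 0 → ‖V z‖ ≤ Real.exp (-z.im * lam * t) := fun z hz =>
    FTLCHS.norm_timeOrderedExp_le ht (FTLCHS.intervalIntegrable_pencil h₀ h₁ z) fun s hs x =>
      FTLCHS.re_inner_pencil_le (ℜ (A s)).2 (ℑ (A s)).2 (hL s hs) hz x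
  have hVk : ∀ z : ℂ, FTLCHS.timeOrderedExp (fun s : ℝ => -Complex.I •
      (z • (ℜ (A s) : Matrix (Fin N) (Fin N) ℂ) + (ℑ (A s) : Matrix (Fin N) (Fin N) ℂ))) t =
      V z := fun z => by
    simp only [V, smul_add, smul_comm z]
  have hVI : V (-Complex.I) = FTLCHS.timeOrderedExp (fun s : ℝ => -A s) t := by
    simp only [V]
    congr 1
    funext s
    conv_rhs => rw [← realPart_add_I_smul_imaginaryPart (A s)]
    rw [smul_smul, neg_mul_neg, Complex.I_mul_I, neg_one_smul, neg_smul, neg_add]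
  let W : ℂ → Matrix (Fin N) (Fin N) ℂ :=
    fun z => (FTLCHS.kernelFun F z * (1 + Complex.I * z)) • V z
  have hWd : ∀ z : ℂ, z.im < 0 → DifferentiableAt ℂ W z := fun z hz =>
    ((hF.differentiableAt_kernelFun ha hz).mul (by fun_prop)).smul (hVd z)
  have hWc : ContinuousOn W {z | z.im ≤ 0} :=
    ((hF.continuousOn_kernelFun ha).mul (by fun_prop)).smul hVd.continuous.continuousOn
  obtain ⟨C, hC0, hC⟩ := hF.exists_norm_kernelFun_mul_le
  -- the decay of the kernel beats the growth of the propagator because `lam * t ≤ a`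
  have hWb : ∀ z : ℂ, z.im ≤ 0 → ‖W z‖ ≤ C := fun z hz => by
    rw [norm_smul]
    calc _ ≤ C * Real.exp (a * z.im) * Real.exp (-z.im * lam * t) :=
          mul_le_mul (hC z hz) (hVb z hz) (norm_nonneg _) (by positivity)
      _ = C * Real.exp (a * z.im + -z.im * lam * t) := by rw [mul_assoc, ← Real.exp_add]
      _ ≤ C := by
          refine mul_le_of_le_one_right hC0 (Real.exp_le_one_iff.2 ?_)
          nlinarith
  have hfun : (fun k : ℝ => (FTLCHS.kernelFun F k / (1 - Complex.I * k)) •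
      FTLCHS.timeOrderedExp (fun s : ℝ => -Complex.I • ((k : ℂ) •
        (ℜ (A s) : Matrix (Fin N) (Fin N) ℂ) + (ℑ (A s) : Matrix (Fin N) (Fin N) ℂ))) t) =
      fun k : ℝ => (1 + k ^ 2)⁻¹ • W k := by
    funext k
    have hk : (1 : ℂ) - Complex.I * k ≠ 0 := fun h => by simpa using congrArg Complex.re h
    have hk' : (1 : ℂ) + k ^ 2 ≠ 0 := by
      have : (1 : ℝ) + k ^ 2 ≠ 0 := by positivity
      exact_mod_cast this
    rw [hVk, ← Complex.coe_smul, smul_smul]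
    congr 1
    push_cast
    rw [div_eq_iff hk, ← mul_assoc, mul_assoc _ (1 + Complex.I * (k : ℂ)),
      show (1 + Complex.I * (k : ℂ)) * (1 - Complex.I * k) = 1 + k ^ 2 by
        linear_combination (-(k : ℂ) ^ 2) * Complex.I_sq]
    field_simp
  simp only [hfun]
  refine ⟨?_, ?_⟩
  · have hcont : Continuous fun k : ℝ => W k :=
      hWc.comp_continuous Complex.continuous_ofReal fun k => by simp
    refine (integrable_inv_one_add_sq.mul_const C).mono'
      (integrable_inv_one_add_sq.aestronglyMeasurable.smul hcont.aestronglyMeasurable)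
      (Filter.Eventually.of_forall fun k => ?_)
    rw [norm_smul, Real.norm_of_nonneg (by positivity)]
    gcongr
    exact hWb k (by simp)
  · rw [FTLCHS.integral_inv_one_add_sq_smul_eq hWd hWc hWb, ← hVI]
    have hpi : (Real.pi : ℂ) ≠ 0 := by exact_mod_cast Real.pi_ne_zero
    simp only [W]
    rw [hF.kernelFun_neg_I, ← Complex.coe_smul, smul_smul, mul_neg, Complex.I_mul_I]
    have : (Real.pi : ℂ) * (1 / (2 * Real.pi) * (1 + - -1)) = 1 := by field_simp; norm_num
    rw [this, one_smul]
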